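/- Let $E$ be a complex Banach lattice, i.e. the complexification $E=X\oplus iX$ of a real Banach lattice $X$, with norm $\|z\|=\||z|\|$, where $|z|=\sup_{\theta\in\mathbb{R}}\operatorname{Re}(e^{i\theta}z)$, and with positive cone $E_+=X_+$. We write $f\ge 0$ for $f\in E_+$, and call a linear operator $P:E\to E$ positive if $P(E_+)\subseteq E_+$. Let $(e^{tA})_{t\ge 0}$ be a $C_0$-semigroup on $E$ with generator $A$, and let $(P_n)_{n\in\mathbb{N}}$ be an increasing sequence of positive linear operators on $E$ (i.e. $P_{n+1}-P_n$ is positive for every $n$) converging strongly to the identity. Assume that the semigroup has the LEP property (local eventual positivity) with respect to $(P_n)_{n\in\mathbb{N}}$: for every $n\in\mathbb{N}$ and every $f\in E_+\setminus\{0\}$ there exists $\tau>0$ (depending on $n$ and $f$) such that $$P_n e^{tA}f\ge 0\qquad\text{for all } t\ge\tau.$$ Let $\sigma(A)$ be the spectrum of $A$, let $\sigma_{\mathrm{ess}}(A)$ be the set of all $\lambda\in\mathbb{C}$ for which $\ker(A-\lambda I)$ or $E/\operatorname{rg}(A-\lambda I)$ is infinite-dimensional, and put $$s(A)=\sup\{\operatorname{Re}\lambda:\lambda\in\sigma(A)\},\qquad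 s_{\mathrm{ess}}(A)=\sup\{\operatorname{Re}\lambda:\lambda\in\sigma_{\mathrm{ess}}(A)\}$$ in $[-\infty,\infty]$, with $\sup\emptyset=-\infty$. If $s_{\mathrm{ess}}(A)<s(A)$, then $s(A)$ is a real number and $s(A)\in\sigma(A)$. -/

import Mathlib

open Filter Topology
open scoped NNReal

noncomputable section

/-! ### Complex Banach lattices

A real Banach lattice is a complete normed space `X` over `ℝ` with a lattice order that is compatible
with addition and with multiplication by non-negative scalars and with a solid (lattice) norm:
`[NormedAddCommGroup X] [NormedSpace ℝ X] [CompleteSpace X] [Lattice X] [IsOrderedAddMonoid X]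
[IsOrderedModule ℝ X] [HasSolidNorm X]`.

A complex Banach lattice is the complexification of a real Banach lattice `X`, with the norm
`‖z‖ = ‖|z|‖`, where `|z| = sup {Re (w z) : w ∈ ℂ, |w| = 1}` is the modulus of `z`. -/

/-- The complexification `X + i X` of a real vector space `X`. -/
@[ext]
structure Complexification (X : Type*) where
  re : X
  im : X

namespace Complexification

section Algebra

variable {X : Type*} [AddCommGroup X]

instance : Zero (Complexification X) := ⟨⟨0, 0⟩⟩
instance : Add (Complexification X) := ⟨fun z w => ⟨z.re + w.re, z.im + w.im⟩⟩
instance : Neg (Complexification X) := ⟨fun z => ⟨-z.re, -z.im⟩⟩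
instance : Sub (Complexification X) := ⟨fun z w => ⟨z.re - w.re, z.im - w.im⟩⟩

@[simp] theorem zero_re : (0 : Complexification X).re = 0 := rfl
@[simp] theorem zero_im : (0 : Complexification X).im = 0 := rfl
@[simp] theorem add_re (z w : Complexification X) : (z + w).re = z.re + w.re := rfl
@[simp] theorem add_im (z w : Complexification X) : (z + w).im = z.im + w.im := rfl
@[simp] theorem neg_re (z : Complexification X) : (-z).re = -z.re := rfl
@[simp] theorem neg_im (z : Complexification X) : (-z).im = -z.im := rfl
@[simp] theorem sub_re (z w : Complexification X) : (z - w).re = z.re - w.re := rfl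
@[simp] theorem sub_im (z w : Complexification X) : (z - w).im = z.im - w.im := rfl

instance : AddCommGroup (Complexification X) where
  add_assoc a b c := by ext <;> simp [add_assoc]
  zero_add a := by ext <;> simp
  add_zero a := by ext <;> simp
  nsmul := nsmulRec
  zsmul := zsmulRec
  neg_add_cancel a := by ext <;> simp
  sub_eq_add_neg a b := by ext <;> simp [sub_eq_add_neg]
  add_comm a b := by ext <;> simp [add_comm]

variable [Module ℝ X]

instance : SMul ℂ (Complexification X) :=
  ⟨fun c z => ⟨c.re • z.re - c.im • z.im, c.re • z.im + c.im • z.re⟩⟩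

@[simp] theorem smul_re (c : ℂ) (z : Complexification X) :
    (c • z).re = c.re • z.re - c.im • z.im := rfl
@[simp] theorem smul_im (c : ℂ) (z : Complexification X) :
    (c • z).im = c.re • z.im + c.im • z.re := rfl

instance : Module ℂ (Complexification X) where
  one_smul z := by ext <;> simp
  mul_smul a b z := by
    ext
    · simp only [smul_re, smul_im, Complex.mul_re, Complex.mul_im]; module
    · simp only [smul_re, smul_im, Complex.mul_re, Complex.mul_im]; module
  smul_zero a := by ext <;> simp
  smul_add a z w := by
    ext
    · simp only [smul_re, add_re, add_im]; module
    · simp only [smul_im, add_re, add_im]; module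
  add_smul a b z := by
    ext
    · simp only [smul_re, add_re, Complex.add_re, Complex.add_im]; module
    · simp only [smul_im, add_im, Complex.add_re, Complex.add_im]; module
  zero_smul z := by ext <;> simp

end Algebra

section Order

theorem norm_le_norm_of_le {X : Type*} [NormedAddCommGroup X] [Lattice X] [IsOrderedAddMonoid X]
    [HasSolidNorm X] {x y : X} (hx : 0 ≤ x) (h : x ≤ y) : ‖x‖ ≤ ‖y‖ :=
  norm_le_norm_of_abs_le_abs (by rwa [abs_of_nonneg hx, abs_of_nonneg (hx.trans h)])

theorem smul_le_abs_smul_abs {X : Type*} [AddCommGroup X] [Module ℝ X] [Lattice X]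
    [IsOrderedModule ℝ X] (c : ℝ) (x : X) : c • x ≤ |c| • |x| := by
  rcases le_total 0 c with hc | hc
  · rw [abs_of_nonneg hc]
    exact smul_le_smul_of_nonneg_left (le_abs_self x) hc
  · rw [abs_of_nonpos hc]
    have := smul_le_smul_of_nonneg_left (neg_le_abs x) (neg_nonneg.2 hc)
    simpa using this

end Order

section Lattice

variable {X : Type*} [NormedAddCommGroup X] [NormedSpace ℝ X] [Lattice X]
  [IsOrderedAddMonoid X] [IsOrderedModule ℝ X]

theorem smul_re_le (c : ℂ) (z : Complexification X) :
    (c • z).re ≤ ‖c‖ • (|z.re| + |z.im|) := by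
  have h1 := smul_le_abs_smul_abs c.re z.re
  have h2 := smul_le_abs_smul_abs (-c.im) z.im
  rw [abs_neg, neg_smul] at h2
  have h3 : |c.re| • |z.re| ≤ ‖c‖ • |z.re| :=
    smul_le_smul_of_nonneg_right (Complex.abs_re_le_norm c) (abs_nonneg _)
  have h4 : |c.im| • |z.im| ≤ ‖c‖ • |z.im| :=
    smul_le_smul_of_nonneg_right (Complex.abs_im_le_norm c) (abs_nonneg _)
  rw [smul_re, smul_add, sub_eq_add_neg]
  exact add_le_add (h1.trans h3) (h2.trans h4)

variable [HasSolidNorm X] [CompleteSpace X]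

/-- In a Banach lattice the supremum defining the modulus exists. -/
theorem exists_modulus (z : Complexification X) :
    ∃ m : X, IsLUB {x : X | ∃ w : ℂ, ‖w‖ = 1 ∧ x = (w • z).re} m := by
  set u : X := |z.re| + |z.im| with hu
  have hu0 : 0 ≤ u := add_nonneg (abs_nonneg _) (abs_nonneg _)
  set S : Set X := {x : X | ∃ w : ℂ, ‖w‖ = 1 ∧ x = (w • z).re} with hS
  have key : ∀ n : ℕ, ∃ a : X, (∀ x ∈ S, x ≤ a + (1 / ((n : ℝ) + 1)) • u) ∧
      ∀ b ∈ upperBounds S, a ≤ b := by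
    intro n
    have hε : (0 : ℝ) < 1 / ((n : ℝ) + 1) := by positivity
    obtain ⟨t, htS, htf, htc⟩ :=
      Metric.finite_approx_of_totallyBounded (isCompact_sphere (0 : ℂ) 1).totallyBounded _ hε
    have hne : htf.toFinset.Nonempty := by
      have h1 := htc (show (1 : ℂ) ∈ Metric.sphere (0 : ℂ) 1 by simp)
      simp only [Set.mem_iUnion] at h1
      obtain ⟨y, hy, -⟩ := h1
      exact ⟨y, by simpa using hy⟩
    refine ⟨htf.toFinset.sup' hne fun w => (w • z).re, ?_, ?_⟩
    · rintro x ⟨w, hw, rfl⟩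
      have h1 := htc (show w ∈ Metric.sphere (0 : ℂ) 1 by simpa using hw)
      simp only [Set.mem_iUnion] at h1
      obtain ⟨y, hy, hwy⟩ := h1
      have h2 : (w • z).re = (y • z).re + ((w - y) • z).re := by
        rw [← add_re, ← add_smul]; congr 2; ring
      have h3 : ‖w - y‖ ≤ 1 / ((n : ℝ) + 1) := by
        rw [← dist_eq_norm]; exact (Metric.mem_ball.1 hwy).le
      rw [h2]
      exact add_le_add
        (Finset.le_sup' (fun w : ℂ => (w • z).re) (by simpa using hy))
        ((smul_re_le _ _).trans (smul_le_smul_of_nonneg_right h3 hu0))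
    · intro b hb
      refine Finset.sup'_le hne _ fun w hw => hb ⟨w, ?_, rfl⟩
      simpa using htS (by simpa using hw)
  choose a ha1 ha2 using key
  have hle : ∀ m n, a m - a n ≤ (1 / ((n : ℝ) + 1)) • u := fun m n =>
    sub_le_iff_le_add'.2 (ha2 m _ fun x hx => ha1 n x hx)
  have hdist : ∀ N m n : ℕ, N ≤ m → N ≤ n → dist (a m) (a n) ≤ 1 / ((N : ℝ) + 1) * ‖u‖ := by
    intro N m n hm hn
    have hmono : ∀ k : ℕ, N ≤ k → (1 / ((k : ℝ) + 1)) • u ≤ (1 / ((N : ℝ) + 1)) • u := by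
      intro k hk
      refine smul_le_smul_of_nonneg_right ?_ hu0
      exact Nat.one_div_le_one_div hk
    have h0 : 0 ≤ (1 / ((N : ℝ) + 1)) • u := smul_nonneg (by positivity) hu0
    have h1 : |a m - a n| ≤ |(1 / ((N : ℝ) + 1)) • u| := by
      rw [abs_of_nonneg h0]
      refine abs_le'.2 ⟨(hle m n).trans (hmono n hn), ?_⟩
      rw [neg_sub]
      exact (hle n m).trans (hmono m hm)
    rw [dist_eq_norm]
    refine (norm_le_norm_of_abs_le_abs h1).trans ?_
    rw [norm_smul, Real.norm_of_nonneg (by positivity)]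
  have hlim : Tendsto (fun N : ℕ => 1 / ((N : ℝ) + 1)) atTop (𝓝 0) :=
    tendsto_one_div_add_atTop_nhds_zero_nat
  have hcau : CauchySeq a := by
    refine cauchySeq_of_le_tendsto_0 (fun N : ℕ => 1 / ((N : ℝ) + 1) * ‖u‖)
      (fun n m N hn hm => hdist N n m hn hm) ?_
    simpa using hlim.mul_const ‖u‖
  obtain ⟨l, hl⟩ := cauchySeq_tendsto_of_complete hcau
  refine ⟨l, fun x hx => ?_, fun b hb => le_of_tendsto' hl fun n => ha2 n b hb⟩
  have h1 : Tendsto (fun n : ℕ => a n + (1 / ((n : ℝ) + 1)) • u) atTop (𝓝 (l + (0 : ℝ) • u)) :=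
    hl.add (hlim.smul_const u)
  rw [zero_smul, add_zero] at h1
  exact ge_of_tendsto' h1 fun n => ha1 n x hx

/-- The modulus `|z| = sup {Re (w z) : w ∈ ℂ, |w| = 1}`, an element of the real Banach lattice. -/
def modulus (z : Complexification X) : X := Classical.choose (exists_modulus z)

theorem isLUB_modulus (z : Complexification X) :
    IsLUB {x : X | ∃ w : ℂ, ‖w‖ = 1 ∧ x = (w • z).re} z.modulus :=
  Classical.choose_spec (exists_modulus z)

theorem smul_re_le_modulus (z : Complexification X) {w : ℂ} (hw : ‖w‖ = 1) :
    (w • z).re ≤ z.modulus := (isLUB_modulus z).1 ⟨w, hw, rfl⟩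

theorem modulus_le {z : Complexification X} {b : X} (h : ∀ w : ℂ, ‖w‖ = 1 → (w • z).re ≤ b) :
    z.modulus ≤ b := (isLUB_modulus z).2 (by rintro x ⟨w, hw, rfl⟩; exact h w hw)

theorem abs_re_le_modulus (z : Complexification X) : |z.re| ≤ z.modulus := by
  refine abs_le'.2 ⟨?_, ?_⟩
  · simpa using smul_re_le_modulus z (w := 1) (by simp)
  · simpa using smul_re_le_modulus z (w := -1) (by simp)

theorem abs_im_le_modulus (z : Complexification X) : |z.im| ≤ z.modulus := by
  refine abs_le'.2 ⟨?_, ?_⟩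
  · simpa using smul_re_le_modulus z (w := -Complex.I) (by simp)
  · simpa using smul_re_le_modulus z (w := Complex.I) (by simp)

theorem modulus_nonneg (z : Complexification X) : 0 ≤ z.modulus :=
  (abs_nonneg _).trans (abs_re_le_modulus z)

theorem modulus_le_add (z : Complexification X) : z.modulus ≤ |z.re| + |z.im| :=
  modulus_le fun w hw => by simpa [hw] using smul_re_le w z

theorem modulus_add_le (z w : Complexification X) : (z + w).modulus ≤ z.modulus + w.modulus :=
  modulus_le fun c hc => by
    rw [smul_add, add_re]
    exact add_le_add (smul_re_le_modulus z hc) (smul_re_le_modulus w hc)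

theorem modulus_smul_le (c : ℂ) (z : Complexification X) : (c • z).modulus ≤ ‖c‖ • z.modulus := by
  refine modulus_le fun w hw => ?_
  rcases eq_or_ne c 0 with rfl | hc
  · simp
  have hc' : (‖c‖ : ℂ) ≠ 0 := by simpa using hc
  have h1 : w • c • z = (‖c‖ : ℂ) • (w * c / ‖c‖) • z := by
    rw [smul_smul, smul_smul]; congr 1; field_simp
  have h2 : ‖w * c / ‖c‖‖ = 1 := by
    have : ‖c‖ ≠ 0 := by simpa using hc
    simp [hw, this]
  have h3 := smul_le_smul_of_nonneg_left (smul_re_le_modulus z h2) (norm_nonneg c)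
  rw [h1, smul_re]
  simpa using h3

instance : Norm (Complexification X) := ⟨fun z => ‖z.modulus‖⟩

theorem norm_def (z : Complexification X) : ‖z‖ = ‖z.modulus‖ := rfl

theorem norm_re_le (z : Complexification X) : ‖z.re‖ ≤ ‖z‖ := by
  rw [norm_def, ← norm_abs_eq_norm z.re]
  exact norm_le_norm_of_le (abs_nonneg _) (abs_re_le_modulus z)

theorem norm_im_le (z : Complexification X) : ‖z.im‖ ≤ ‖z‖ := by
  rw [norm_def, ← norm_abs_eq_norm z.im]
  exact norm_le_norm_of_le (abs_nonneg _) (abs_im_le_modulus z)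

theorem norm_le_add (z : Complexification X) : ‖z‖ ≤ ‖z.re‖ + ‖z.im‖ := by
  rw [norm_def, ← norm_abs_eq_norm z.re, ← norm_abs_eq_norm z.im]
  exact (norm_le_norm_of_le (modulus_nonneg z) (modulus_le_add z)).trans (norm_add_le _ _)

theorem normedSpaceCore : NormedSpace.Core ℂ (Complexification X) where
  norm_nonneg z := norm_nonneg z.modulus
  norm_smul c z := by
    have hle : ∀ (c : ℂ) (z : Complexification X), ‖c • z‖ ≤ ‖c‖ * ‖z‖ := fun c z => by
      have := norm_le_norm_of_le (modulus_nonneg _) (modulus_smul_le c z)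
      rwa [norm_smul, norm_norm] at this
    refine le_antisymm (hle c z) ?_
    rcases eq_or_ne c 0 with rfl | hc
    · rw [norm_zero, zero_mul]
      exact norm_nonneg (modulus ((0 : ℂ) • z))
    have h := hle c⁻¹ (c • z)
    rw [inv_smul_smul₀ hc, norm_inv] at h
    have hc' : 0 < ‖c‖ := norm_pos_iff.2 hc
    rwa [inv_mul_eq_div, le_div_iff₀' hc'] at h
  norm_triangle z w :=
    (norm_le_norm_of_le (modulus_nonneg _) (modulus_add_le z w)).trans (norm_add_le _ _)
  norm_eq_zero_iff z := by
    refine ⟨fun h => ?_, fun h => ?_⟩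
    · have h1 := norm_re_le z
      have h2 := norm_im_le z
      rw [h] at h1 h2
      exact Complexification.ext (norm_le_zero_iff.1 h1) (norm_le_zero_iff.1 h2)
    · subst h
      have h1 := norm_le_add (0 : Complexification X)
      simp only [zero_re, zero_im, norm_zero, add_zero] at h1
      exact le_antisymm h1 (norm_nonneg (modulus (0 : Complexification X)))

instance : NormedAddCommGroup (Complexification X) := NormedAddCommGroup.ofCore normedSpaceCore

instance : NormedSpace ℂ (Complexification X) := NormedSpace.ofCore normedSpaceCore

theorem exists_tendsto_of_cauchySeq (f : ℕ → Complexification X) (hf : CauchySeq f) :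
    ∃ a, Tendsto f atTop (𝓝 a) := by
  have hre : CauchySeq fun n => (f n).re := by
    refine Metric.cauchySeq_iff'.2 fun ε hε => ?_
    obtain ⟨N, hN⟩ := Metric.cauchySeq_iff'.1 hf ε hε
    refine ⟨N, fun n hn => ?_⟩
    have h := hN n hn
    rw [dist_eq_norm] at h ⊢
    exact (norm_re_le (f n - f N)).trans_lt h
  have him : CauchySeq fun n => (f n).im := by
    refine Metric.cauchySeq_iff'.2 fun ε hε => ?_
    obtain ⟨N, hN⟩ := Metric.cauchySeq_iff'.1 hf ε hε
    refine ⟨N, fun n hn => ?_⟩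
    have h := hN n hn
    rw [dist_eq_norm] at h ⊢
    exact (norm_im_le (f n - f N)).trans_lt h
  obtain ⟨x, hx⟩ := cauchySeq_tendsto_of_complete hre
  obtain ⟨y, hy⟩ := cauchySeq_tendsto_of_complete him
  have h0 : Tendsto (fun n => ‖(f n).re - x‖ + ‖(f n).im - y‖) atTop (𝓝 0) := by
    simpa using
      (tendsto_iff_norm_sub_tendsto_zero.1 hx).add (tendsto_iff_norm_sub_tendsto_zero.1 hy)
  refine ⟨Complexification.mk x y, tendsto_iff_norm_sub_tendsto_zero.2 ?_⟩
  exact squeeze_zero (fun n => norm_nonneg (f n - Complexification.mk x y))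
    (fun n => norm_le_add (f n - Complexification.mk x y)) h0

instance : CompleteSpace (Complexification X) :=
  Metric.complete_of_cauchySeq_tendsto exists_tendsto_of_cauchySeq

end Lattice

section Positivity

variable {X : Type*} [AddCommGroup X] [Lattice X]

/-- The positive cone `E₊` of the complexification `E` of `X`: the elements `x + i 0` with `x ≥ 0`. -/
def positiveCone (X : Type*) [AddCommGroup X] [Lattice X] : Set (Complexification X) :=
  {z | 0 ≤ z.re ∧ z.im = 0}

variable [Module ℝ X]

/-- A linear operator is positive if it maps the positive cone into itself. -/
def IsPositiveOperator (T : Complexification X →ₗ[ℂ] Complexification X) : Prop :=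
  ∀ f ∈ positiveCone X, T f ∈ positiveCone X

end Positivity

end Complexification

/-! ### `C₀`-semigroups and their generators -/

/-- A `C₀`-semigroup of bounded linear operators on a complex normed space. -/
structure C0Semigroup (E : Type*) [NormedAddCommGroup E] [NormedSpace ℂ E] where
  /-- the operator at time `t ≥ 0` -/
  op : ℝ≥0 → E →L[ℂ] E
  op_zero : op 0 = ContinuousLinearMap.id ℂ E
  op_add : ∀ s t, op (s + t) = (op s).comp (op t)
  continuous_orbit : ∀ f, Continuous fun t => op t f

namespace C0Semigroup

variable {E : Type*} [NormedAddCommGroup E] [NormedSpace ℂ E] (T : C0Semigroup E)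

/-- `g = lim_{h ↓ 0} (T(h) f - f) / h`. -/
def HasGeneratorAt (f g : E) : Prop :=
  Tendsto (fun h : ℝ≥0 => ((h : ℝ) : ℂ)⁻¹ • (T.op h f - f)) (𝓝[>] 0) (𝓝 g)

/-- The generator: `D(A)` consists of all `f` for which `lim_{h ↓ 0} (T(h) f - f) / h` exists, and
`A f` is this limit. -/
def generator : E →ₗ.[ℂ] E where
  domain :=
    { carrier := {f | ∃ g, T.HasGeneratorAt f g}
      zero_mem' := ⟨0, by simp [HasGeneratorAt]⟩
      add_mem' := by
        rintro a b ⟨g, hg⟩ ⟨k, hk⟩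
        refine ⟨g + k, (Tendsto.add hg hk).congr fun h => ?_⟩
        rw [map_add]; module
      smul_mem' := by
        rintro c a ⟨g, hg⟩
        refine ⟨c • g, (Tendsto.const_smul hg c).congr fun h => ?_⟩
        rw [map_smul]; module }
  toFun :=
    { toFun := fun f => Classical.choose f.2
      map_add' := fun a b => by
        refine tendsto_nhds_unique (Classical.choose_spec (a + b).2)
          ((Tendsto.add (Classical.choose_spec a.2) (Classical.choose_spec b.2)).congr fun h => ?_)
        rw [Submodule.coe_add, map_add]; module
      map_smul' := fun c a => by
        refine tendsto_nhds_unique (Classical.choose_spec (c • a).2)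
          ((Tendsto.const_smul (Classical.choose_spec a.2) c).congr fun h => ?_)
        rw [Submodule.coe_smul, map_smul]; module }

theorem hasGeneratorAt_generator (f : T.generator.domain) :
    T.HasGeneratorAt f (T.generator f) := Classical.choose_spec f.2

end C0Semigroup

/-! ### Spectrum and essential spectrum of unbounded operators -/

namespace LinearPMap

variable {E : Type*} [NormedAddCommGroup E] [NormedSpace ℂ E] (A : E →ₗ.[ℂ] E)

/-- The set of all `μ` for which `μ - A : D(A) → E` is bijective with a bounded inverse `R`. -/
def resolventSet : Set ℂ :=
  {μ | ∃ R : E →L[ℂ] E,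
    (∀ f : E, ∃ h : R f ∈ A.domain, μ • R f - A ⟨R f, h⟩ = f) ∧
    ∀ f : A.domain, R (μ • (f : E) - A f) = f}

/-- The spectrum `σ(A)`. -/
def spectrum : Set ℂ := (A.resolventSet)ᶜ

/-- The operator `A - μ` with domain `D(A)`. -/
def subScalar (μ : ℂ) : A.domain →ₗ[ℂ] E := A.toFun - μ • A.domain.subtype

/-- The Fredholm domain: all `μ` for which the kernel and the cokernel of `A - μ` are
finite-dimensional. -/
def fredholmDomain : Set ℂ :=
  {μ | FiniteDimensional ℂ (LinearMap.ker (A.subScalar μ)) ∧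
    FiniteDimensional ℂ (E ⧸ LinearMap.range (A.subScalar μ))}

/-- The essential spectrum `σ_ess(A)`. -/
def essentialSpectrum : Set ℂ := (A.fredholmDomain)ᶜ

/-- The spectral bound `s(A) ∈ [-∞, ∞]`, equal to `-∞` if the spectrum is empty. -/
def spectralBound : EReal := sSup ((fun μ : ℂ => (μ.re : EReal)) '' A.spectrum)

/-- The essential spectral bound `s_ess(A) ∈ [-∞, ∞]`. -/
def essentialSpectralBound : EReal := sSup ((fun μ : ℂ => (μ.re : EReal)) '' A.essentialSpectrum)

end LinearPMap

/-! ### Local eventual positivity -/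

/-- `T` has the LEP property with respect to `(P n)`: the `P n` are positive operators, increasing in
`n` and converging strongly to the identity, and for all `n` and `0 ≠ f ∈ E₊` there is `τ > 0` such
that `P n (T(t) f) ∈ E₊` for all `t ≥ τ`. -/
structure HasLEP {X : Type*} [NormedAddCommGroup X] [NormedSpace ℝ X] [CompleteSpace X]
    [Lattice X] [IsOrderedAddMonoid X] [IsOrderedModule ℝ X] [HasSolidNorm X]
    (T : C0Semigroup (Complexification X))
    (P : ℕ → Complexification X →ₗ[ℂ] Complexification X) : Prop where
  positive : ∀ n, Complexification.IsPositiveOperator (P n)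
  increasing : ∀ n, Complexification.IsPositiveOperator (P (n + 1) - P n)
  tendsto_id : ∀ f, Tendsto (fun n => P n f) atTop (𝓝 f)
  eventually_positive : ∀ n, ∀ f ∈ Complexification.positiveCone X, f ≠ 0 →
    ∃ τ : ℝ≥0, 0 < τ ∧ ∀ t, τ ≤ t → P n (T.op t f) ∈ Complexification.positiveCone X

end

/-! The semigroup is exponentially bounded, so `s = s(A) < ∞`, and `s_ess(A) < s(A)` excludes `-∞`.
Suppose `s` lay in the resolvent set. That set is open, so some `c < s` with `c > s_ess(A)` has the
whole real ray `(c, ∞)` in the resolvent set, while the half-plane `Re z > c` lies in the Fredholm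
domain.

Positivity enters through scalar functions. For `f ≥ 0`, a positive functional `φ` and an index `n`,
the function `φ (P_n e^{tA} f)` is non-negative from some time `τ` on, and its Laplace transform is
`φ (P_n (z - A)⁻¹ f)` for large `Re z`. The part over `[0, τ]` is entire; the rest is the transform
of a positive measure, whose abscissa of convergence is a singularity by Landau's theorem
(`Iio_subset_integrableExpSet`). Since the resolvent is holomorphic near the ray, the integral
converges for `Re z > c`, which gives a holomorphic extension to the half-plane
(`C0Semigroup.exists_extension`). Each scalar function is treated alone, so `τ` may depend on `n`
and `f`.

The functionals `φ ∘ P_n` separate points. An eigenvector at a limit point `μ` of the resolvent set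
would give some scalar function a pole at `μ`; without one, the Fredholm property puts `μ` in the
resolvent set. A connectedness argument (`LinearPMap.halfPlane_subset_resolventSet`) then frees `Re
z > c` of spectrum, so `s ≤ c`, a contradiction. -/

noncomputable section
-- Resolvents of unbounded operators and continuation across the Fredholm domain
namespace LinearPMap

variable {E : Type*} [NormedAddCommGroup E] [NormedSpace ℂ E] {A : E →ₗ.[ℂ] E}

/-- `R` is the inverse of `μ - A`. -/
def IsResolventAt (A : E →ₗ.[ℂ] E) (μ : ℂ) (R : E →L[ℂ] E) : Prop :=
  (∀ f : E, ∃ h : R f ∈ A.domain, μ • R f - A ⟨R f, h⟩ = f) ∧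
    ∀ f : A.domain, R (μ • (f : E) - A f) = f

open Classical in
/-- The resolvent `(μ - A)⁻¹`, and `0` outside the resolvent set. -/
def res (A : E →ₗ.[ℂ] E) (μ : ℂ) : E →L[ℂ] E :=
  if h : μ ∈ A.resolventSet then Classical.choose h else 0

theorem isResolventAt_res {μ : ℂ} (h : μ ∈ A.resolventSet) : A.IsResolventAt μ (A.res μ) := by
  rw [res, dif_pos h]
  exact Classical.choose_spec h

theorem IsResolventAt.mem {μ : ℂ} {R : E →L[ℂ] E} (h : A.IsResolventAt μ R) :
    μ ∈ A.resolventSet := ⟨R, h⟩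

theorem IsResolventAt.unique {μ : ℂ} {R S : E →L[ℂ] E} (hR : A.IsResolventAt μ R)
    (hS : A.IsResolventAt μ S) : R = S := by
  ext f
  obtain ⟨h, hf⟩ := hS.1 f
  have := hR.2 ⟨S f, h⟩
  rwa [hf] at this

theorem IsResolventAt.res_eq {μ : ℂ} {R : E →L[ℂ] E} (h : A.IsResolventAt μ R) : A.res μ = R :=
  (isResolventAt_res h.mem).unique h

theorem IsResolventAt.map_smul_sub {μ : ℂ} {R : E →L[ℂ] E} (h : A.IsResolventAt μ R)
    {x : E} (hx : x ∈ A.domain) : R (A ⟨x, hx⟩) = μ • R x - x := by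
  have := h.2 ⟨x, hx⟩
  rw [_root_.map_sub, _root_.map_smul] at this
  rw [eq_sub_iff_add_eq, ← eq_sub_iff_add_eq', this]

/-- On the domain, `z - A = (1 + (z - μ) R) (μ - A)`, so inverting the bounded factor inverts `z -
A`. The resulting formula yields both the openness of the resolvent set and the holomorphy of the
resolvent. -/
theorem IsResolventAt.perturb {μ z : ℂ} {R : E →L[ℂ] E} (h : A.IsResolventAt μ R)
    (hu : IsUnit (1 + (z - μ) • R)) :
    A.IsResolventAt z (R * Ring.inverse (1 + (z - μ) • R)) := by
  set B := 1 + (z - μ) • R with hB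
  set N := Ring.inverse B
  have h1 : B * N = 1 := Ring.mul_inverse_cancel _ hu
  have h2 : N * B = 1 := Ring.inverse_mul_cancel _ hu
  have hcomm : R * B = B * R := by simp [hB, mul_add, add_mul]
  have h3 : R * N = N * R := by
    calc R * N = (N * B) * R * N := by rw [h2, one_mul]
      _ = N * (R * B) * N := by rw [hcomm, mul_assoc N]
      _ = N * R := by rw [mul_assoc, mul_assoc, h1, mul_one]
  constructor
  · intro f
    obtain ⟨hd, hf⟩ := h.1 (N f)
    refine ⟨hd, ?_⟩
    have h4 : N f + (z - μ) • R (N f) = f := by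
      have := congrArg (fun S : E →L[ℂ] E => S f) h1
      simpa [hB] using this
    have h5 : A ⟨R (N f), hd⟩ = μ • R (N f) - N f := by
      rw [eq_sub_iff_add_eq, ← eq_sub_iff_add_eq', hf]
    change z • R (N f) - A ⟨R (N f), hd⟩ = f
    rw [h5]
    nth_rewrite 4 [← h4]
    module
  · rintro ⟨x, hx⟩
    have h4 : N (x + (z - μ) • R x) = x := by
      have := congrArg (fun S : E →L[ℂ] E => S x) h2
      simpa [hB] using this
    rw [h3]
    change N (R (z • x - A ⟨x, hx⟩)) = x
    rw [_root_.map_sub, h.map_smul_sub hx, _root_.map_smul]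
    nth_rewrite 4 [← h4]
    congr 1
    module

variable [CompleteSpace E]

theorem isUnit_one_add_smul {z : ℂ} {R : E →L[ℂ] E} (h : ‖z‖ * ‖R‖ < 1) :
    IsUnit (1 + z • R) := by
  have := isUnit_one_sub_of_norm_lt_one (x := -(z • R)) (by rwa [norm_neg, norm_smul])
  simpa using this

theorem IsResolventAt.eventually_isUnit (R : E →L[ℂ] E) (μ : ℂ) :
    ∀ᶠ z in 𝓝 μ, IsUnit (1 + (z - μ) • R) := by
  have : ContinuousAt (fun z => ‖z - μ‖ * ‖R‖) μ := by fun_prop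
  filter_upwards [this.eventually (gt_mem_nhds (show ‖μ - μ‖ * ‖R‖ < 1 by simp))] with z hz
  exact isUnit_one_add_smul hz

theorem isOpen_resolventSet (A : E →ₗ.[ℂ] E) : IsOpen A.resolventSet := by
  rw [isOpen_iff_mem_nhds]
  intro μ hμ
  filter_upwards [IsResolventAt.eventually_isUnit (A.res μ) μ] with z hz
  exact ((isResolventAt_res hμ).perturb hz).mem

theorem differentiableAt_res {μ : ℂ} (hμ : μ ∈ A.resolventSet) : DifferentiableAt ℂ A.res μ := by
  have h1 : A.res =ᶠ[𝓝 μ]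
      fun z => A.res μ * Ring.inverse (1 + (z - μ) • A.res μ) := by
    filter_upwards [IsResolventAt.eventually_isUnit (A.res μ) μ] with z hz
    exact ((isResolventAt_res hμ).perturb hz).res_eq
  refine DifferentiableAt.congr_of_eventuallyEq ?_ h1
  have h2 : DifferentiableAt ℂ (fun z : ℂ => 1 + (z - μ) • A.res μ) μ := by fun_prop
  have h3 : DifferentiableAt ℂ (Ring.inverse : (E →L[ℂ] E) → _) (1 + (μ - μ) • A.res μ) :=
    differentiableAt_inverse (by simp)
  exact (DifferentiableAt.comp μ h3 h2).const_mul _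

theorem differentiableOn_res_apply (A : E →ₗ.[ℂ] E) (ℓ : E →L[ℂ] ℂ) (f : E) :
    DifferentiableOn ℂ (fun z => ℓ (A.res z f)) A.resolventSet := fun z hz => by
  have h := differentiableAt_res hz
  exact (ℓ.differentiableAt.comp z (h.clm_apply (differentiableAt_const f))).differentiableWithinAt

/-- A limit point of the resolvent set at which `A - μ` is injective with a range of finite
codimension belongs to the resolvent set. -/
theorem mem_resolventSet_of_mem_closure {μ : ℂ} (hμ : μ ∈ _root_.closure A.resolventSet)
    (hF : μ ∈ A.fredholmDomain) (hker : ∀ h : A.domain, A h = μ • (h : E) → (h : E) = 0) :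
    μ ∈ A.resolventSet := by
  obtain ⟨z₀, hz₀⟩ : A.resolventSet.Nonempty := closure_nonempty_iff.1 ⟨μ, hμ⟩
  set R := A.res z₀
  have hR : A.IsResolventAt z₀ R := isResolventAt_res hz₀
  -- `B = (A - μ) R` is a bounded substitute for `A - μ`: it has the same range, and it is injective
  -- when `A - μ` is.
  set B : E →L[ℂ] E := (z₀ - μ) • R - 1 with hB
  have hBR : ∀ (f : E) (h : R f ∈ A.domain), B f = A ⟨R f, h⟩ - μ • R f := by
    intro f h
    obtain ⟨_, h2⟩ := hR.1 f
    have h3 : A ⟨R f, h⟩ = z₀ • R f - f := by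
      rw [eq_sub_iff_add_eq, ← eq_sub_iff_add_eq', h2]
    rw [h3, hB]
    simp only [_root_.sub_apply, _root_.smul_apply,
      one_apply_eq_self]
    module
  have hkerB : B.ker = ⊥ := by
    rw [LinearMap.ker_eq_bot']
    intro f hf
    obtain ⟨h, hfA⟩ := hR.1 f
    have h0 : A ⟨R f, h⟩ = μ • R f := sub_eq_zero.1 ((hBR f h).symm.trans hf)
    have h1 : R f = 0 := hker ⟨R f, h⟩ h0
    rw [← hfA, h0, h1]
    simp
  have hrange : B.range = LinearMap.range (A.subScalar μ) := by
    ext g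
    constructor
    · rintro ⟨f, rfl⟩
      obtain ⟨h, -⟩ := hR.1 f
      exact ⟨⟨R f, h⟩, (hBR f h).symm⟩
    · rintro ⟨x, rfl⟩
      refine ⟨z₀ • (x : E) - A x, ?_⟩
      have hx := hR.2 x
      have h : R (z₀ • (x : E) - A x) ∈ A.domain := by rw [hx]; exact x.2
      refine (hBR _ h).trans ?_
      have : (⟨_, h⟩ : A.domain) = x := Subtype.ext hx
      rw [this, hx]
      rfl
  have hfin : FiniteDimensional ℂ (E ⧸ B.range) := by rw [hrange]; exact hF.2
  obtain ⟨G, hG⟩ := Submodule.exists_isCompl B.range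
  have : FiniteDimensional ℂ G :=
    LinearEquiv.finiteDimensional (Submodule.quotientEquivOfIsCompl _ _ hG)
  -- A range with a closed algebraic complement is closed; being injective, `B` is then bounded
  -- below.
  have hclosed : _root_.IsClosed (B.range : Set E) :=
    B.closed_complemented_range_of_isCompl_of_ker_eq_bot G hG G.closed_of_finiteDimensional hkerB
  obtain ⟨K, hK⟩ := B.antilipschitz_of_injective_of_isClosed_range
    (LinearMap.ker_eq_bot.1 hkerB) hclosed
  have hK' : ∀ f, ‖f‖ ≤ K * ‖B f‖ := fun f => by
    simpa using hK.le_mul_dist f 0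
  -- `C` bounds the resolvents at all resolvent points `z` within `1 / C` of `μ`: there the term in
  -- `‖S g‖` on the right of `h1` is at most `‖S g‖ / 2` and is absorbed. Then `‖μ - z‖ * ‖S‖ < 1`,
  -- and a Neumann series reaches `μ` from `z`.
  set C : ℝ := 2 * (‖R‖ * K) + 1
  have hC : 0 < C := by positivity
  obtain ⟨z, hz, hzμ⟩ := Metric.mem_closure_iff.1 hμ (1 / C) (by positivity)
  rw [dist_eq_norm, lt_div_iff₀ hC] at hzμ
  have hS := isResolventAt_res hz
  set S := A.res z
  have hSC : ‖S‖ ≤ C := by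
    refine S.opNorm_le_bound hC.le fun g => ?_
    obtain ⟨h, hg⟩ := hS.1 g
    set f := z₀ • S g - A ⟨S g, h⟩ with hf
    have hRf : R f = S g := hR.2 ⟨S g, h⟩
    have hBf : B f = (z - μ) • S g - g := by
      have hd : R f ∈ A.domain := by rw [hRf]; exact h
      rw [hBR f hd]
      have : (⟨R f, hd⟩ : A.domain) = ⟨S g, h⟩ := Subtype.ext hRf
      rw [this, hRf]
      nth_rewrite 4 [← hg]
      module
    have h1 : ‖S g‖ ≤ ‖R‖ * K * (‖μ - z‖ * ‖S g‖ + ‖g‖) := by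
      rw [← hRf]
      calc ‖R f‖ ≤ ‖R‖ * ‖f‖ := R.le_opNorm f
        _ ≤ ‖R‖ * (K * ‖B f‖) := by gcongr; exact hK' f
        _ ≤ ‖R‖ * (K * (‖μ - z‖ * ‖R f‖ + ‖g‖)) := by
          gcongr
          rw [hBf, hRf, norm_sub_rev μ, ← norm_smul]
          exact norm_sub_le _ _
        _ = _ := by ring
    have h2 : ‖R‖ * K * ‖μ - z‖ ≤ 1 / 2 := by
      have : ‖μ - z‖ * (2 * (‖R‖ * K)) ≤ ‖μ - z‖ * C := by gcongr; simp [C]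
      linarith
    have h3 : ‖R‖ * K * ‖μ - z‖ * ‖S g‖ ≤ 1 / 2 * ‖S g‖ := by gcongr
    simp only [C]
    nlinarith [norm_nonneg g]
  refine (hS.perturb (isUnit_one_add_smul (z := μ - z) ?_)).mem
  exact (mul_le_mul_of_nonneg_left hSC (norm_nonneg _)).trans_lt hzμ

/-- Let the half-plane `{Re z > c}` be contained in the Fredholm domain of `A` and contain resolvent
points. If for a separating family of functionals `ℓ` all functions `ℓ ((z - A)⁻¹ f)` extend
holomorphically to the half-plane, then the half-plane is contained in the resolvent set. -/
theorem halfPlane_subset_resolventSet {c ω : ℝ} {ι : Type*} (ℓ : ι → E →L[ℂ] ℂ)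
    (hsep : ∀ f, (∀ i, ℓ i f = 0) → f = 0)
    (hF : ∀ z : ℂ, c < z.re → z ∈ A.fredholmDomain)
    (hω : ∀ z : ℂ, ω < z.re → z ∈ A.resolventSet)
    (hext : ∀ i f, ∃ G : ℂ → ℂ, DifferentiableOn ℂ G {z | c < z.re} ∧
      ∀ z : ℂ, ω < z.re → G z = ℓ i (A.res z f)) :
    {z : ℂ | c < z.re} ⊆ A.resolventSet := by
  choose G hG hGω using hext
  -- Agreement with `G` is carried along with membership, because the resolvent set within the
  -- half-plane is not known to be connected. It remains to show that `V` is relatively closed.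
  set V : Set ℂ := {z | ∀ᶠ w in 𝓝 z, w ∈ A.resolventSet ∧ ∀ i f, ℓ i (A.res w f) = G i f w}
  have hVopen : IsOpen V := isOpen_setOfPred_eventually_nhds
  have hH : IsOpen {z : ℂ | c < z.re} := isOpen_lt continuous_const Complex.continuous_re
  suffices h : {z : ℂ | c < z.re} ⊆ V from fun z hz => (h hz).self_of_nhds.1
  refine (convex_halfSpace_re_gt c).isPreconnected.subset_of_closure_inter_subset hVopen ?_ ?_
  · refine ⟨((max c ω + 1 : ℝ) : ℂ), ?_, ?_⟩
    · simp only [Set.mem_ofPred_eq, Complex.ofReal_re]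
      linarith [le_max_left c ω]
    · have : IsOpen {z : ℂ | ω < z.re} := isOpen_lt continuous_const Complex.continuous_re
      filter_upwards [this.mem_nhds (x := ((max c ω + 1 : ℝ) : ℂ))
        (by simp only [Set.mem_ofPred_eq, Complex.ofReal_re]; linarith [le_max_right c ω])] with w hw
      exact ⟨hω w hw, fun i f => (hGω i f w hw).symm⟩
  · rintro μ ⟨hμV, hμ⟩
    have hμcl : μ ∈ _root_.closure A.resolventSet := closure_mono (fun z hz => hz.self_of_nhds.1) hμV
    have hμρ : μ ∈ A.resolventSet := by
      by_contra hn
      refine hn (mem_resolventSet_of_mem_closure hμcl (hF μ hμ) fun h hh => hsep _ fun i => ?_)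
      -- If `A h = μ h`, then `(z - A)⁻¹ h = (z - μ)⁻¹ h`. Continuity of `G` at `μ` leaves no room
      -- for this pole, so `ℓ i h = 0`.
      have hfr : ∃ᶠ z in 𝓝 μ, (z - μ) * G i h z = ℓ i h := by
        refine (mem_closure_iff_frequently.1 hμV).mono fun z hz => ?_
        have hz1 := hz.self_of_nhds
        have hR := (isResolventAt_res hz1.1).2 h
        rw [hh, ← sub_smul, _root_.map_smul] at hR
        rw [← hz1.2 i h, ← smul_eq_mul, ← _root_.map_smul, hR]
      have hc : ContinuousAt (fun z => (z - μ) * G i h z) μ := by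
        have := ((hG i h).differentiableAt (hH.mem_nhds hμ)).continuousAt
        fun_prop
      by_contra hne
      have h0 : (fun z => (z - μ) * G i h z) μ ≠ ℓ i h := by simpa using Ne.symm hne
      exact hfr (hc.eventually_ne h0)
    obtain ⟨r, hr, hball⟩ := Metric.isOpen_iff.1 ((isOpen_resolventSet A).inter hH) μ ⟨hμρ, hμ⟩
    obtain ⟨z, hzV, hzμ⟩ := Metric.mem_closure_iff.1 hμV r hr
    rw [dist_comm] at hzμ
    filter_upwards [Metric.ball_mem_nhds μ hr] with w hw
    refine ⟨(hball hw).1, fun i f => ?_⟩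
    have h1 : AnalyticOnNhd ℂ (fun z => ℓ i (A.res z f)) (Metric.ball μ r) :=
      ((differentiableOn_res_apply A (ℓ i) f).mono fun z hz => (hball hz).1).analyticOnNhd
        Metric.isOpen_ball
    have h2 : AnalyticOnNhd ℂ (G i f) (Metric.ball μ r) :=
      ((hG i f).mono fun z hz => (hball hz).2).analyticOnNhd Metric.isOpen_ball
    refine h1.eqOn_of_preconnected_of_eventuallyEq h2 (convex_ball μ r).isPreconnected hzμ ?_ hw
    filter_upwards [hzV] with y hy using hy.2 i f

end LinearPMap
end

noncomputable section
-- The Laplace transform of a semigroup is the resolvent of its generator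
open MeasureTheory Set

namespace C0Semigroup

variable {E : Type*} [NormedAddCommGroup E] [NormedSpace ℂ E] (T : C0Semigroup E)

theorem HasGeneratorAt.mem_domain {T : C0Semigroup E} {f g : E} (h : T.HasGeneratorAt f g) :
    f ∈ T.generator.domain := ⟨g, h⟩

theorem HasGeneratorAt.generator_eq {T : C0Semigroup E} {f g : E} (h : T.HasGeneratorAt f g) :
    T.generator ⟨f, h.mem_domain⟩ = g :=
  tendsto_nhds_unique (T.hasGeneratorAt_generator ⟨f, h.mem_domain⟩) h

/-- Uniform boundedness gives a bound `M ≥ 1` on `[0, 1]`; the semigroup law propagates it to `M ^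
(⌊t⌋ + 1) ≤ M * exp (t * log M)`. -/
theorem exists_norm_op_le [CompleteSpace E] :
    ∃ M ω : ℝ, ∀ t : ℝ≥0, ‖T.op t‖ ≤ M * Real.exp (ω * t) := by
  obtain ⟨C, hC⟩ : ∃ C, ∀ t : Icc (0 : ℝ≥0) 1, ‖T.op t‖ ≤ C := by
    refine banach_steinhaus fun f => ?_
    obtain ⟨C, hC⟩ := (isCompact_Icc (a := (0 : ℝ≥0)) (b := 1)).exists_bound_of_continuousOn
      (T.continuous_orbit f).continuousOn
    exact ⟨C, fun t => hC t t.2⟩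
  set M := max C 1
  have hM1 : 1 ≤ M := le_max_right _ _
  have hM : ∀ t : ℝ≥0, t ≤ 1 → ‖T.op t‖ ≤ M := fun t ht =>
    (hC ⟨t, zero_le, ht⟩).trans (le_max_left _ _)
  have hn : ∀ n : ℕ, ∀ t : ℝ≥0, t ≤ n + 1 → ‖T.op t‖ ≤ M ^ (n + 1) := by
    intro n
    induction n with
    | zero => intro t ht; simpa using hM t (by simpa using ht)
    | succ n ih =>
      intro t ht
      rcases le_total t 1 with h | h
      · exact (hM t h).trans (le_self_pow₀ hM1 (by simp))
      · have h1 : t - 1 ≤ n + 1 := by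
          rw [tsub_le_iff_right]; exact_mod_cast ht
        rw [← tsub_add_cancel_of_le h, T.op_add, pow_succ]
        exact (ContinuousLinearMap.opNorm_comp_le _ _).trans
          (mul_le_mul (ih _ h1) (hM 1 le_rfl) (norm_nonneg _) (by positivity))
  refine ⟨M, Real.log M, fun t => ?_⟩
  have h0 : 0 < M := by linarith
  refine (hn ⌊t⌋₊ t (Nat.lt_floor_add_one t).le).trans ?_
  rw [pow_succ', ← Real.rpow_def_of_pos h0]
  refine mul_le_mul_of_nonneg_left ?_ h0.le
  rw [← Real.rpow_natCast]
  exact Real.rpow_le_rpow_of_exponent_le hM1 (by exact_mod_cast Nat.floor_le (zero_le (a := t)))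

/-- The orbit of `f`, extended to negative times as a constant. -/
def orbit (f : E) (t : ℝ) : E := T.op t.toNNReal f

theorem continuous_orbit' (f : E) : Continuous (T.orbit f) :=
  (T.continuous_orbit f).comp continuous_real_toNNReal

theorem orbit_add (f : E) {s : ℝ} (hs : 0 ≤ s) (h : ℝ≥0) :
    T.orbit f (s + h) = T.op h (T.orbit f s) := by
  rw [orbit, Real.toNNReal_add hs h.coe_nonneg, Real.toNNReal_coe, add_comm, T.op_add]
  rfl

theorem norm_orbit_le {T : C0Semigroup E} {M ω : ℝ}
    (hM : ∀ t : ℝ≥0, ‖T.op t‖ ≤ M * Real.exp (ω * t)) (f : E) {t : ℝ} (ht : 0 ≤ t) :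
    ‖T.orbit f t‖ ≤ M * Real.exp (ω * t) * ‖f‖ := by
  have := (T.op t.toNNReal).le_of_opNorm_le (hM _) f
  rwa [Real.coe_toNNReal t ht] at this

theorem norm_exp_smul_orbit_le {T : C0Semigroup E} {M ω : ℝ}
    (hM : ∀ t : ℝ≥0, ‖T.op t‖ ≤ M * Real.exp (ω * t)) (z : ℂ) (f : E) {t : ℝ} (ht : 0 ≤ t) :
    ‖Complex.exp (-z * t) • T.orbit f t‖ ≤ M * Real.exp (-(z.re - ω) * t) * ‖f‖ := by
  rw [norm_smul, Complex.norm_exp]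
  refine (mul_le_mul_of_nonneg_left (norm_orbit_le hM f ht) (Real.exp_pos _).le).trans_eq ?_
  rw [show -(z.re - ω) * t = (-z * t).re + ω * t by simp; ring, Real.exp_add]
  ring

theorem integrable_bound {M a : ℝ} (ha : 0 < a) (C : ℝ) :
    Integrable (fun t => M * Real.exp (-a * t) * C) (volume.restrict (Ioi 0)) :=
  ((exp_neg_integrableOn_Ioi 0 ha).const_mul M).mul_const C

theorem integrableOn_exp_smul_orbit {T : C0Semigroup E} {M ω : ℝ}
    (hM : ∀ t : ℝ≥0, ‖T.op t‖ ≤ M * Real.exp (ω * t)) {z : ℂ} (hz : ω < z.re) (f : E) :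
    IntegrableOn (fun t : ℝ => Complex.exp (-z * t) • T.orbit f t) (Ioi 0) := by
  refine Integrable.mono' (integrable_bound (M := M) (sub_pos.2 hz) ‖f‖) ?_ ?_
  · have := T.continuous_orbit' f
    exact Continuous.aestronglyMeasurable (by fun_prop)
  · filter_upwards [ae_restrict_mem measurableSet_Ioi] with t ht
    exact norm_exp_smul_orbit_le hM z f (mem_Ioi.1 ht).le

/-- The Laplace transform of the semigroup. -/
def laplace {T : C0Semigroup E} {M ω : ℝ}
    (hM : ∀ t : ℝ≥0, ‖T.op t‖ ≤ M * Real.exp (ω * t)) {z : ℂ} (hz : ω < z.re) : E →L[ℂ] E :=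
  LinearMap.mkContinuous
    { toFun := fun f => ∫ t : ℝ in Ioi 0, Complex.exp (-z * t) • T.orbit f t
      map_add' := fun f g => by
        rw [← integral_add (integrableOn_exp_smul_orbit hM hz f)
          (integrableOn_exp_smul_orbit hM hz g)]
        simp [orbit]
      map_smul' := fun c f => by
        rw [RingHom.id_apply, ← integral_smul]
        refine integral_congr_ae (ae_of_all _ fun t => ?_)
        simp only [orbit, map_smul]
        rw [smul_comm] }
    (∫ t : ℝ in Ioi 0, M * Real.exp (-(z.re - ω) * t)) fun f => by
      rw [← integral_mul_const]
      refine norm_integral_le_of_norm_le (integrable_bound (sub_pos.2 hz) ‖f‖) ?_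
      filter_upwards [ae_restrict_mem measurableSet_Ioi] with t ht
      exact norm_exp_smul_orbit_le hM z f (mem_Ioi.1 ht).le

theorem laplace_apply {T : C0Semigroup E} {M ω : ℝ}
    (hM : ∀ t : ℝ≥0, ‖T.op t‖ ≤ M * Real.exp (ω * t)) {z : ℂ} (hz : ω < z.re) (f : E) :
    laplace hM hz f = ∫ t : ℝ in Ioi 0, Complex.exp (-z * t) • T.orbit f t := rfl

variable [CompleteSpace E]

/-- Applying `T(h)` shifts the integration variable, which produces the factor `e^{zh}` and removes
`[0, h]` from the domain of integration. The right-hand side is differentiable at `h = 0` even if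
the orbit of `f` is not. -/
theorem op_laplace {T : C0Semigroup E} {M ω : ℝ}
    (hM : ∀ t : ℝ≥0, ‖T.op t‖ ≤ M * Real.exp (ω * t)) {z : ℂ} (hz : ω < z.re) (f : E) (h : ℝ≥0) :
    T.op h (laplace hM hz f) = Complex.exp (z * (h : ℝ)) • (laplace hM hz f -
      ∫ t : ℝ in (0 : ℝ)..h, Complex.exp (-z * t) • T.orbit f t) := by
  have hint := integrableOn_exp_smul_orbit hM hz f
  have h1 : laplace hM hz f - ∫ t : ℝ in (0 : ℝ)..h, Complex.exp (-z * t) • T.orbit f t =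
      ∫ t : ℝ in Ioi (h : ℝ), Complex.exp (-z * t) • T.orbit f t := by
    rw [laplace_apply, sub_eq_iff_eq_add', intervalIntegral.integral_of_le h.coe_nonneg,
      ← setIntegral_union (Ioc_disjoint_Ioi le_rfl) measurableSet_Ioi
        (hint.mono_set Ioc_subset_Ioi_self) (hint.mono_set (Ioi_subset_Ioi h.coe_nonneg)),
      Ioc_union_Ioi_eq_Ioi h.coe_nonneg]
  have h2 : ∫ t : ℝ in Ioi (h : ℝ), Complex.exp (-z * t) • T.orbit f t =
      ∫ t : ℝ in Ioi (0 : ℝ), Complex.exp (-z * (t + h : ℝ)) • T.orbit f (t + h) := by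
    have := (measurePreserving_add_right volume (h : ℝ)).setIntegral_preimage_emb
      (measurableEmbedding_addRight (h : ℝ))
      (fun t : ℝ => Complex.exp (-z * t) • T.orbit f t) (Ioi (h : ℝ))
    rw [← this, preimage_add_const_Ioi, sub_self]
  rw [h1, h2, laplace_apply, ← ContinuousLinearMap.integral_comp_comm _ hint, ← integral_smul]
  refine setIntegral_congr_fun measurableSet_Ioi fun t ht => ?_
  simp only [map_smul]
  rw [T.orbit_add f (mem_Ioi.1 ht).le, smul_smul, ← Complex.exp_add]
  congr 2
  push_cast
  ring

theorem hasGeneratorAt_laplace {T : C0Semigroup E} {M ω : ℝ}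
    (hM : ∀ t : ℝ≥0, ‖T.op t‖ ≤ M * Real.exp (ω * t)) {z : ℂ} (hz : ω < z.re) (f : E) :
    T.HasGeneratorAt (laplace hM hz f) (z • laplace hM hz f - f) := by
  set R := laplace hM hz f with hR
  set g : ℝ → E := fun t => Complex.exp (-z * t) • T.orbit f t with hg
  have hgc : Continuous g := by
    have := T.continuous_orbit' f
    fun_prop
  have h1 : HasDerivAt (fun h : ℝ => ∫ t in (0 : ℝ)..h, g t) (g 0) 0 :=
    intervalIntegral.integral_hasDerivAt_right (hgc.intervalIntegrable _ _)
      (hgc.stronglyMeasurableAtFilter _ _) hgc.continuousAt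
  have h2 : HasDerivAt (fun h : ℝ => Complex.exp (z * h)) z 0 := by
    have := ((Complex.ofRealCLM.hasDerivAt (x := (0 : ℝ))).const_mul z).cexp
    simpa using this
  have h3 := (h2.smul (h1.const_sub R)).tendsto_slope_zero_right
  have h4 : Tendsto (fun h : ℝ≥0 => (h : ℝ)) (𝓝[>] 0) (𝓝[>] 0) :=
    tendsto_nhdsWithin_of_tendsto_nhds_of_eventually_within _
      (NNReal.continuous_coe.continuousAt.tendsto.mono_left nhdsWithin_le_nhds)
      (eventually_mem_nhdsWithin.mono fun y hy => NNReal.coe_pos.2 hy)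
  have h5 := h3.comp h4
  have hg0 : g 0 = f := by simp [hg, orbit, T.op_zero]
  have h6 : Complex.exp (z * (0 : ℝ)) • -g 0 + z • (R - ∫ t in (0 : ℝ)..0, g t) = z • R - f := by
    rw [hg0]; simp; abel
  rw [h6] at h5
  refine h5.congr fun h => ?_
  simp only [Function.comp, zero_add, Pi.smul_apply', intervalIntegral.integral_same, sub_zero,
    Complex.ofReal_zero, mul_zero, Complex.exp_zero, one_smul]
  rw [op_laplace, ← Complex.ofReal_inv]
  rfl

theorem isResolventAt_laplace {T : C0Semigroup E} {M ω : ℝ}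
    (hM : ∀ t : ℝ≥0, ‖T.op t‖ ≤ M * Real.exp (ω * t)) {z : ℂ} (hz : ω < z.re) :
    T.generator.IsResolventAt z (laplace hM hz) := by
  constructor
  · intro f
    refine ⟨(hasGeneratorAt_laplace hM hz f).mem_domain, ?_⟩
    rw [(hasGeneratorAt_laplace hM hz f).generator_eq]
    abel
  · intro f
    set R := laplace hM hz
    -- The left inverse property needs `A R f = R A f` on the domain, which follows from `R`
    -- commuting with the semigroup.
    have hcomm : ∀ (h : ℝ≥0) (x : E), T.op h (R x) = R (T.op h x) := by
      intro h x
      rw [laplace_apply, laplace_apply,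
        ← ContinuousLinearMap.integral_comp_comm _ (integrableOn_exp_smul_orbit hM hz x)]
      refine setIntegral_congr_fun measurableSet_Ioi fun t _ => ?_
      simp only [map_smul, orbit]
      rw [← ContinuousLinearMap.comp_apply, ← ContinuousLinearMap.comp_apply, ← T.op_add,
        ← T.op_add, add_comm]
    have h1 : T.HasGeneratorAt (R f) (R (T.generator f)) := by
      refine ((R.continuous.tendsto _).comp (T.hasGeneratorAt_generator f)).congr fun h => ?_
      simp only [Function.comp, map_smul, map_sub, hcomm]
    have h2 := tendsto_nhds_unique h1 (hasGeneratorAt_laplace hM hz (f : E))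
    rw [map_sub, map_smul, h2]
    abel

end C0Semigroup
end

noncomputable section
-- Pringsheim's and Landau's theorems for measures on the half-line
open MeasureTheory ProbabilityTheory Set

theorem integrableExpSet_lower {μ : Measure ℝ} (hμ : ∀ᵐ t ∂μ, 0 ≤ t) {x y : ℝ} (hxy : x ≤ y)
    (hy : y ∈ integrableExpSet id μ) : x ∈ integrableExpSet id μ := by
  refine Integrable.mono' hy (by fun_prop) ?_
  filter_upwards [hμ] with t ht
  rw [Real.norm_of_nonneg (Real.exp_pos _).le]
  exact Real.exp_le_exp.2 (mul_le_mul_of_nonneg_right hxy ht)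

/-- Pringsheim's theorem for power series, for a moment-generating function. -/
theorem mem_integrableExpSet_of_differentiableOn_ball {μ : Measure ℝ} (hμ : ∀ᵐ t ∂μ, 0 ≤ t)
    {x r : ℝ} (hx : x ∈ interior (integrableExpSet id μ)) {H : ℂ → ℂ}
    (hH : DifferentiableOn ℂ H (Metric.ball (x : ℂ) r)) (heq : H =ᶠ[𝓝 (x : ℂ)] complexMGF id μ)
    {y : ℝ} (hxy : x ≤ y) (hy : y < x + r) : y ∈ integrableExpSet id μ := by
  set m : ℕ → ℝ := fun k => ∫ t, t ^ k * Real.exp (x * t) ∂μ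
  have hder : ∀ k, iteratedDeriv k H x = (m k : ℂ) := by
    intro k
    rw [heq.iteratedDeriv_eq, iteratedDeriv_complexMGF (by simpa using hx), ← integral_complex_ofReal]
    simp
  have hsum := Complex.hasSum_taylorSeries_on_ball hH (z := (y : ℂ)) (by
    rw [Metric.mem_ball, dist_eq_norm, ← Complex.ofReal_sub, Complex.norm_real,
      Real.norm_of_nonneg (by linarith)]; linarith)
  have hs : Summable fun k : ℕ => ((k.factorial : ℝ))⁻¹ * ((y - x) ^ k * m k) := by
    rw [← Complex.summable_ofReal]
    refine hsum.summable.congr fun k => ?_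
    rw [hder]
    push_cast [smul_eq_mul]
    rfl
  have hint : ∀ k : ℕ, Integrable (fun t => ((k.factorial : ℝ))⁻¹ * ((y - x) ^ k *
      (t ^ k * Real.exp (x * t)))) μ := fun k =>
    ((integrable_pow_mul_exp_of_mem_interior_integrableExpSet hx k).const_mul _).const_mul _
  have hnn : ∀ k : ℕ, 0 ≤ᵐ[μ] (fun t => ((k.factorial : ℝ))⁻¹ * ((y - x) ^ k *
      (t ^ k * Real.exp (x * t)))) := fun k => by
    filter_upwards [hμ] with t ht
    have : 0 ≤ y - x := by linarith
    simp only [Pi.zero_apply]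
    positivity
  have hexp : ∀ t, HasSum (fun k : ℕ => ((k.factorial : ℝ))⁻¹ * ((y - x) ^ k *
      (t ^ k * Real.exp (x * t)))) (Real.exp (y * t)) := fun t => by
    have h1 : HasSum (fun k : ℕ => ((y - x) * t) ^ k / (k.factorial : ℝ))
        (Real.exp ((y - x) * t)) := by
      rw [Real.exp_eq_exp_ℝ]
      exact NormedSpace.expSeries_div_hasSum_exp _
    have h2 := h1.mul_right (Real.exp (x * t))
    rw [← Real.exp_add, show (y - x) * t + x * t = y * t by ring] at h2
    refine h2.congr_fun fun k => ?_
    rw [mul_pow]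
    ring
  refine ⟨by fun_prop, ?_⟩
  rw [hasFiniteIntegral_iff_ofReal (ae_of_all _ fun t => (Real.exp_pos _).le)]
  -- The Taylor coefficients at `x` are moments of a positive measure, hence non-negative, so
  -- Tonelli turns convergence of the Taylor series at `y` into finiteness of the integral.
  calc ∫⁻ t, ENNReal.ofReal (Real.exp (y * id t)) ∂μ
      = ∫⁻ t, ∑' k : ℕ, ENNReal.ofReal (((k.factorial : ℝ))⁻¹ * ((y - x) ^ k *
          (t ^ k * Real.exp (x * t)))) ∂μ := by
        refine lintegral_congr_ae ?_
        filter_upwards [ae_all_iff.2 hnn] with t ht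
        rw [id, ← (hexp t).tsum_eq, ENNReal.ofReal_tsum_of_nonneg ht (hexp t).summable]
    _ = ∑' k : ℕ, ∫⁻ t, ENNReal.ofReal (((k.factorial : ℝ))⁻¹ * ((y - x) ^ k *
          (t ^ k * Real.exp (x * t)))) ∂μ := lintegral_tsum fun k => by fun_prop
    _ = ∑' k : ℕ, ENNReal.ofReal (((k.factorial : ℝ))⁻¹ * ((y - x) ^ k * m k)) := by
        refine tsum_congr fun k => ?_
        rw [← ofReal_integral_eq_lintegral_ofReal (hint k) (hnn k), integral_const_mul,
          integral_const_mul]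
    _ < ⊤ := hs.tsum_ofReal_ne_top.lt_top

/-- Landau's theorem: the abscissa of convergence of the moment-generating function of a measure on
`[0, ∞)` is a singularity. -/
theorem Iio_subset_integrableExpSet {μ : Measure ℝ} (hμ : ∀ᵐ t ∂μ, 0 ≤ t) {a b : ℝ}
    (hb : Iio b ⊆ integrableExpSet id μ) {H : ℂ → ℂ} {W : Set ℂ} (hW : IsOpen W)
    (hH : DifferentiableOn ℂ H W) (hray : ∀ x : ℝ, x < a → (x : ℂ) ∈ W)
    (heq : ∀ z : ℂ, z.re < b → H z = complexMGF id μ z) : Iio a ⊆ integrableExpSet id μ := by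
  intro x hx
  by_contra hxD
  set D := integrableExpSet id μ with hD
  have hDx : ∀ y ∈ D, y < x := fun y hy => by
    by_contra! h
    exact hxD (integrableExpSet_lower hμ h hy)
  have hbdd : BddAbove D := ⟨x, fun y hy => (hDx y hy).le⟩
  have hne : D.Nonempty := ⟨b - 1, hb (by simp)⟩
  set S := sSup D
  have hSx : S ≤ x := csSup_le hne fun y hy => (hDx y hy).le
  have hIio : Iio S ⊆ D := fun y hy => by
    obtain ⟨z, hz, hyz⟩ := exists_lt_of_lt_csSup hne hy
    exact integrableExpSet_lower hμ hyz.le hz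
  have hint : Iio S ⊆ interior D := interior_maximal hIio isOpen_Iio
  have hbS : b ≤ S := by
    by_contra! h
    obtain ⟨y, hy1, hy2⟩ := exists_between h
    exact absurd (le_csSup hbdd (hb hy2)) (not_le.2 hy1)
  obtain ⟨ε, hε, hball⟩ := Metric.isOpen_iff.1 hW S (hray S (hSx.trans_lt hx))
  -- Only the real ray is known to lie in `W`, which need not be connected, so the identity theorem
  -- is run along the ray.
  set U : Set ℂ := (fun y : ℝ => (y : ℂ)) '' Iio S with hU
  have hUp : IsPreconnected U := isPreconnected_Iio.image _ (by fun_prop)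
  have hHan : AnalyticOnNhd ℂ H U := by
    rintro _ ⟨y, hy, rfl⟩
    exact hH.analyticAt (hW.mem_nhds (hray y ((mem_Iio.1 hy).trans (hSx.trans_lt hx))))
  have hMan : AnalyticOnNhd ℂ (complexMGF id μ) U := by
    rintro _ ⟨y, hy, rfl⟩
    exact analyticAt_complexMGF (by simpa using hint hy)
  have hbU : ((b - 1 : ℝ) : ℂ) ∈ U := ⟨b - 1, by simp only [mem_Iio]; linarith, rfl⟩
  have hnear : H =ᶠ[𝓝 ((b - 1 : ℝ) : ℂ)] complexMGF id μ := by
    have : IsOpen {z : ℂ | z.re < b} := isOpen_lt Complex.continuous_re continuous_const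
    filter_upwards [this.mem_nhds (x := ((b - 1 : ℝ) : ℂ)) (by simp)] with z hz using heq z hz
  have hEq : EqOn H (complexMGF id μ) U :=
    hHan.eqOn_of_preconnected_of_eventuallyEq hMan hUp hbU hnear
  -- The ball of radius `3ε/4` about `S - ε/4` stays inside the `ε`-ball about `S` and contains `S +
  -- ε/4`, beyond the supremum.
  set s : ℝ := S - ε / 4 with hs
  have hsS : s ∈ Iio S := by simp only [mem_Iio]; linarith
  have hsU : (s : ℂ) ∈ U := ⟨s, hsS, rfl⟩
  have hsEq : H =ᶠ[𝓝 (s : ℂ)] complexMGF id μ := by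
    refine ((hHan _ hsU).frequently_eq_iff_eventually_eq (hMan _ hsU)).1 ?_
    have h1 : ∃ᶠ y in 𝓝[≠] s, y ∈ Iio S :=
      Filter.Eventually.frequently (mem_nhdsWithin_of_mem_nhds (isOpen_Iio.mem_nhds hsS))
    have h2 : Tendsto (fun y : ℝ => (y : ℂ)) (𝓝[≠] s) (𝓝[≠] (s : ℂ)) :=
      tendsto_nhdsWithin_of_tendsto_nhds_of_eventually_within _
        (Complex.continuous_ofReal.continuousAt.tendsto.mono_left nhdsWithin_le_nhds)
        (eventually_mem_nhdsWithin.mono fun y hy h => hy (Complex.ofReal_injective h))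
    exact h2.frequently (h1.mono fun y hy => hEq ⟨y, hy, rfl⟩)
  have hmem : S + ε / 4 ∈ D :=
    mem_integrableExpSet_of_differentiableOn_ball hμ (hint hsS) (r := 3 / 4 * ε)
      (hH.mono ((Metric.ball_subset_ball' (by
        rw [dist_eq_norm, ← Complex.ofReal_sub, Complex.norm_real, hs]
        rw [Real.norm_eq_abs, show S - ε / 4 - S = -(ε / 4) by ring, abs_neg,
          abs_of_pos (by linarith)]
        linarith)).trans hball)) hsEq (by linarith) (by linarith)
  linarith [le_csSup hbdd hmem]
end

noncomputable section
-- Positive functionals and boundedness of the operators `P_n`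
namespace Complexification

theorem mem_positiveCone_mk {X : Type*} [AddCommGroup X] [Lattice X] {x : X} (hx : 0 ≤ x) :
    (⟨x, 0⟩ : Complexification X) ∈ positiveCone X := ⟨hx, rfl⟩

theorem eq_positive_decomposition {X : Type*} [AddCommGroup X] [Module ℝ X] [Lattice X]
    [IsOrderedAddMonoid X] (z : Complexification X) :
    z = (⟨z.re⁺, 0⟩ - ⟨z.re⁻, 0⟩ : Complexification X) +
      Complex.I • (⟨z.im⁺, 0⟩ - ⟨z.im⁻, 0⟩ : Complexification X) := by
  ext <;> simp [posPart_sub_negPart]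

/-- Hahn–Banach separates a vector outside the closed positive cone from the cone; for non-zero `x ≥
0` this applies to `-x`. -/
theorem exists_positive_dual_ne_zero {X : Type*} [NormedAddCommGroup X] [NormedSpace ℝ X]
    [Lattice X] [IsOrderedAddMonoid X] [IsOrderedModule ℝ X] [HasSolidNorm X] {x : X} (hx : x ≠ 0) :
    ∃ φ : StrongDual ℝ X, (∀ y, 0 ≤ y → 0 ≤ φ y) ∧ φ x ≠ 0 := by
  have key : ∀ x : X, ¬ 0 ≤ x → ∃ φ : StrongDual ℝ X, (∀ y, 0 ≤ y → 0 ≤ φ y) ∧ φ x ≠ 0 := by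
    intro x hx
    obtain ⟨φ, hφ, hφx⟩ := (ProperCone.positive ℝ X).hyperplane_separation_point (x₀ := x)
      (by simpa using hx)
    exact ⟨φ, fun y hy => hφ y (by simpa using hy), hφx.ne⟩
  by_cases h : 0 ≤ x
  · obtain ⟨φ, hφ, hφx⟩ := key (-x) fun h' => hx (le_antisymm (neg_nonneg.1 h') h)
    exact ⟨φ, hφ, by simpa using hφx⟩
  · exact key x h

variable {X : Type*} [NormedAddCommGroup X] [NormedSpace ℝ X] [Lattice X]
  [IsOrderedAddMonoid X] [IsOrderedModule ℝ X] [HasSolidNorm X] [CompleteSpace X]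

/-- The complex-linear extension of a real functional. -/
def extendDual (φ : StrongDual ℝ X) : Complexification X →L[ℂ] ℂ :=
  LinearMap.mkContinuous
    { toFun := fun z => (φ z.re : ℂ) + φ z.im * Complex.I
      map_add' := fun z w => by simp; ring
      map_smul' := fun c z => by
        apply Complex.ext <;> simp }
    (2 * ‖φ‖) fun z => by
      have h1 := (φ.le_opNorm z.re).trans (mul_le_mul_of_nonneg_left (norm_re_le z) (norm_nonneg φ))
      have h2 := (φ.le_opNorm z.im).trans (mul_le_mul_of_nonneg_left (norm_im_le z) (norm_nonneg φ))
      refine (norm_add_le _ _).trans ?_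
      rw [norm_mul, Complex.norm_I, Complex.norm_real, Complex.norm_real]
      linarith

theorem extendDual_apply (φ : StrongDual ℝ X) (z : Complexification X) :
    extendDual φ z = (φ z.re : ℂ) + φ z.im * Complex.I := rfl

theorem eq_zero_of_forall_positive_dual {z : Complexification X}
    (h : ∀ φ : StrongDual ℝ X, (∀ y, 0 ≤ y → 0 ≤ φ y) → extendDual φ z = 0) : z = 0 := by
  have h' : ∀ φ : StrongDual ℝ X, (∀ y, 0 ≤ y → 0 ≤ φ y) → φ z.re = 0 ∧ φ z.im = 0 := by
    intro φ hφ
    have := h φ hφ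
    rw [extendDual_apply] at this
    exact ⟨by simpa using congrArg Complex.re this, by simpa using congrArg Complex.im this⟩
  ext
  · by_contra hne
    obtain ⟨φ, hφ, hx⟩ := exists_positive_dual_ne_zero hne
    exact hx (h' φ hφ).1
  · by_contra hne
    obtain ⟨φ, hφ, hx⟩ := exists_positive_dual_ne_zero hne
    exact hx (h' φ hφ).2

/-- An operator between `0` and the identity is bounded. -/
theorem exists_continuousLinearMap_of_le_id {P : Complexification X →ₗ[ℂ] Complexification X}
    (hP : IsPositiveOperator P) (hle : ∀ f ∈ positiveCone X, (P f).re ≤ f.re) :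
    ∃ Q : Complexification X →L[ℂ] Complexification X, ∀ f, Q f = P f := by
  have h1 : ∀ x y : X, 0 ≤ x → x ≤ |y| → ‖P ⟨x, 0⟩‖ ≤ ‖y‖ := by
    intro x y hx hxy
    have h2 := hP _ (mem_positiveCone_mk hx)
    refine (norm_le_add _).trans ?_
    rw [h2.2, norm_zero, add_zero, ← norm_abs_eq_norm y]
    exact norm_le_norm_of_le h2.1 ((hle _ (mem_positiveCone_mk hx)).trans hxy)
  -- One unit for each of the four positive parts of `z`, whose images have norm at most `‖z‖`.
  refine ⟨P.mkContinuous 4 fun z => ?_, fun f => rfl⟩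
  conv_lhs => rw [eq_positive_decomposition z]
  rw [map_add, map_smul, map_sub, map_sub]
  have hpos : ∀ x : X, x⁺ ≤ |x| := fun x => sup_le (le_abs_self x) (abs_nonneg x)
  have hneg : ∀ x : X, x⁻ ≤ |x| := fun x => sup_le (neg_le_abs x) (abs_nonneg x)
  have e1 := (h1 _ z.re (posPart_nonneg _) (hpos _)).trans (norm_re_le z)
  have e2 := (h1 _ z.re (negPart_nonneg _) (hneg _)).trans (norm_re_le z)
  have e3 := (h1 _ z.im (posPart_nonneg _) (hpos _)).trans (norm_im_le z)
  have e4 := (h1 _ z.im (negPart_nonneg _) (hneg _)).trans (norm_im_le z)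
  refine (norm_add_le _ _).trans ?_
  rw [norm_smul, Complex.norm_I, one_mul]
  linarith [norm_sub_le (P ⟨z.re⁺, 0⟩) (P ⟨z.re⁻, 0⟩), norm_sub_le (P ⟨z.im⁺, 0⟩) (P ⟨z.im⁻, 0⟩)]

/-- The members of an increasing sequence of operators converging strongly to the identity lie below
the identity. -/
theorem re_le_of_increasing {P : ℕ → Complexification X →ₗ[ℂ] Complexification X}
    (hinc : ∀ n, IsPositiveOperator (P (n + 1) - P n))
    (hlim : ∀ f, Tendsto (fun n => P n f) atTop (𝓝 f)) (n : ℕ) {f : Complexification X}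
    (hf : f ∈ positiveCone X) : (P n f).re ≤ f.re := by
  have hmono : Monotone fun n => (P n f).re := monotone_nat_of_le_succ fun n => by
    have := (hinc n f hf).1
    rwa [LinearMap.sub_apply, sub_re, sub_nonneg] at this
  have hre : Tendsto (fun n => (P n f).re) atTop (𝓝 f.re) :=
    tendsto_iff_norm_sub_tendsto_zero.2
      (squeeze_zero (fun _ => norm_nonneg _) (fun n => norm_re_le (P n f - f))
        (tendsto_iff_norm_sub_tendsto_zero.1 (hlim f)))
  exact hmono.ge_of_tendsto hre n

end Complexification
end

noncomputable section
-- Holomorphic extension of the scalar resolvent functions and the main theorem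
open MeasureTheory Set ProbabilityTheory

/-- This disposes of the times before `τ`, where no sign is known: they contribute no singularity.
-/
theorem differentiable_intervalIntegral_exp_mul {u : ℝ → ℂ} (hu : Continuous u) {τ : ℝ}
    (hτ : 0 ≤ τ) : Differentiable ℂ fun z : ℂ => ∫ t in (0 : ℝ)..τ, Complex.exp (z * t) * u t := by
  intro z
  obtain ⟨B, hB⟩ := (isCompact_Icc (a := (0 : ℝ)) (b := τ)).exists_bound_of_continuousOn
    hu.continuousOn
  have hB0 : 0 ≤ B := (norm_nonneg _).trans (hB 0 ⟨le_rfl, hτ⟩)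
  refine (intervalIntegral.hasDerivAt_integral_of_dominated_loc_of_deriv_le
    (F := fun (z : ℂ) (t : ℝ) => Complex.exp (z * t) * u t)
    (F' := fun (z : ℂ) (t : ℝ) => Complex.exp (z * t) * t * u t)
    (bound := fun _ => Real.exp ((‖z‖ + 1) * τ) * τ * B) (Metric.ball_mem_nhds z one_pos)
    ?_ ?_ ?_ ?_ ?_ ?_).2.differentiableAt
  · exact Eventually.of_forall fun w => Continuous.aestronglyMeasurable (by fun_prop)
  · exact Continuous.intervalIntegrable (by fun_prop) _ _
  · exact Continuous.aestronglyMeasurable (by fun_prop)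
  · refine ae_of_all _ fun t ht w hw => ?_
    rw [uIoc_of_le hτ] at ht
    have h1 : ‖w‖ ≤ ‖z‖ + 1 := by
      have := norm_le_norm_add_norm_sub' w z
      rw [Metric.mem_ball, dist_eq_norm] at hw
      linarith
    have h2 : ‖Complex.exp (w * t)‖ ≤ Real.exp ((‖z‖ + 1) * τ) := by
      rw [Complex.norm_exp]
      refine Real.exp_le_exp.2 ((Complex.re_le_norm _).trans ?_)
      rw [norm_mul, Complex.norm_real, Real.norm_of_nonneg ht.1.le]
      exact mul_le_mul h1 ht.2 ht.1.le (by positivity)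
    rw [norm_mul, norm_mul, Complex.norm_real, Real.norm_of_nonneg ht.1.le]
    exact mul_le_mul (mul_le_mul h2 ht.2 ht.1.le (by positivity)) (hB t ⟨ht.1.le, ht.2⟩)
      (norm_nonneg _) (by positivity)
  · exact intervalIntegrable_const
  · refine ae_of_all _ fun t _ w _ => ?_
    have h1 : HasDerivAt (fun w : ℂ => w * t) (t : ℂ) w := by
      simpa using (hasDerivAt_id w).mul_const (t : ℂ)
    exact h1.cexp.mul_const _

/-- If `ℓ (e^{tA} f)` is eventually non-negative and the ray `(c, ∞)` belongs to the resolvent set,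
then `ℓ ((z - A)⁻¹ f)` extends holomorphically to the half-plane `{Re z > c}`. -/
theorem C0Semigroup.exists_extension {E : Type*} [NormedAddCommGroup E] [NormedSpace ℂ E]
    [CompleteSpace E] {T : C0Semigroup E} {M ω : ℝ}
    (hM : ∀ t : ℝ≥0, ‖T.op t‖ ≤ M * Real.exp (ω * t)) {c : ℝ}
    (hray : ∀ x : ℝ, c < x → (x : ℂ) ∈ T.generator.resolventSet) (ℓ : E →L[ℂ] ℂ) (f : E) {τ : ℝ}
    (hτ : 0 ≤ τ) (hpos : ∀ t, τ ≤ t → ∃ r : ℝ, 0 ≤ r ∧ ℓ (T.orbit f t) = r) :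
    ∃ G : ℂ → ℂ, DifferentiableOn ℂ G {z | c < z.re} ∧
      ∀ z : ℂ, ω < z.re → G z = ℓ (T.generator.res z f) := by
  set u : ℝ → ℂ := fun t => ℓ (T.orbit f t) with hu
  have huc : Continuous u := ℓ.continuous.comp (T.continuous_orbit' f)
  set v : ℝ → ℝ := fun t => (u t).re with hv
  have hvc : Continuous v := Complex.continuous_re.comp huc
  have hv0 : ∀ t, τ ≤ t → 0 ≤ v t ∧ u t = v t := by
    intro t ht
    obtain ⟨r, hr, h⟩ := hpos t ht
    simp only [hv, hu, h, Complex.ofReal_re]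
    exact ⟨hr, trivial⟩
  -- The moment-generating function of `μ` has kernel `e^{zt}`, so it is the tail of the Laplace
  -- transform at `-z`; hence the reflections `-ω`, `-c` and `-z` below.
  set μ : Measure ℝ := (volume.restrict (Ioi τ)).withDensity fun t => ENNReal.ofReal (v t) with hμ
  have hmeas : Measurable fun t => ENNReal.ofReal (v t) := by fun_prop
  have hac : μ ≪ volume.restrict (Ioi τ) := withDensity_absolutelyContinuous _ _
  have hμ0 : ∀ᵐ t ∂μ, 0 ≤ t := hac.ae_le <| by
    filter_upwards [ae_restrict_mem measurableSet_Ioi] with t ht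
    exact hτ.trans (mem_Ioi.1 ht).le
  have hint : ∀ z : ℂ, z.re < -ω → IntegrableOn (fun t : ℝ => Complex.exp (z * t) * u t) (Ioi 0) := by
    intro z hz
    have := ℓ.integrable_comp (integrableOn_exp_smul_orbit hM (z := -z) (by simpa using lt_neg.1 hz) f)
    simpa [map_smul, IntegrableOn, hu] using this
  have hmgf : ∀ z : ℂ, complexMGF id μ z = ∫ t in Ioi τ, Complex.exp (z * t) * u t := by
    intro z
    rw [complexMGF, hμ, integral_withDensity_eq_integral_toReal_smul hmeas
      (ae_of_all _ fun _ => ENNReal.ofReal_lt_top)]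
    refine setIntegral_congr_fun measurableSet_Ioi fun t ht => ?_
    obtain ⟨h0, h1⟩ := hv0 t (mem_Ioi.1 ht).le
    simp only [id]
    rw [ENNReal.toReal_ofReal h0, h1, Complex.real_smul, mul_comm]
  have hb : Iio (-ω) ⊆ integrableExpSet id μ := by
    intro x hx
    change Integrable _ _
    rw [hμ, integrable_withDensity_iff_integrable_smul' hmeas
      (ae_of_all _ fun _ => ENNReal.ofReal_lt_top)]
    have h1 := ((hint x (by simpa using hx)).mono_set (Ioi_subset_Ioi hτ)).re
    refine (integrable_congr ?_).1 h1
    filter_upwards [ae_restrict_mem measurableSet_Ioi] with t ht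
    obtain ⟨h0, h1⟩ := hv0 t (mem_Ioi.1 ht).le
    rw [ENNReal.toReal_ofReal h0, h1, ← Complex.ofReal_mul, ← Complex.ofReal_exp,
      ← Complex.ofReal_mul, smul_eq_mul, mul_comm (v t)]
    exact Complex.ofReal_re _
  have hres : ∀ z : ℂ, z.re < -ω → ℓ (T.generator.res (-z) f) =
      (∫ t in (0 : ℝ)..τ, Complex.exp (z * t) * u t) + complexMGF id μ z := by
    intro z hz
    have hz' : ω < (-z).re := by simpa using lt_neg.1 hz
    rw [(isResolventAt_laplace hM hz').res_eq, laplace_apply,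
      ← ContinuousLinearMap.integral_comp_comm _ (integrableOn_exp_smul_orbit hM hz' f), hmgf,
      intervalIntegral.integral_of_le hτ,
      ← setIntegral_union (Ioc_disjoint_Ioi le_rfl) measurableSet_Ioi
        ((hint z hz).mono_set Ioc_subset_Ioi_self) ((hint z hz).mono_set (Ioi_subset_Ioi hτ)),
      Ioc_union_Ioi_eq_Ioi hτ]
    simp [hu]
  have hent := differentiable_intervalIntegral_exp_mul huc hτ
  have hD : Iio (-c) ⊆ integrableExpSet id μ := by
    refine Iio_subset_integrableExpSet hμ0 hb
      (H := fun z => ℓ (T.generator.res (-z) f) - ∫ t in (0 : ℝ)..τ, Complex.exp (z * t) * u t)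
      (W := Neg.neg ⁻¹' T.generator.resolventSet)
      ((LinearPMap.isOpen_resolventSet _).preimage continuous_neg) ?_ ?_ ?_
    · refine DifferentiableOn.sub ?_ hent.differentiableOn
      exact (LinearPMap.differentiableOn_res_apply _ ℓ f).comp differentiable_neg.differentiableOn
        fun z hz => hz
    · intro x hx
      rw [mem_preimage, ← Complex.ofReal_neg]
      exact hray _ (lt_neg.1 hx)
    · intro z hz
      rw [hres z hz, add_sub_cancel_left]
  refine ⟨fun z => (∫ t in (0 : ℝ)..τ, Complex.exp (-z * t) * u t) + complexMGF id μ (-z), ?_, ?_⟩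
  · refine DifferentiableOn.add
      (hent.comp differentiable_neg).differentiableOn
      (differentiableOn_complexMGF.comp differentiable_neg.differentiableOn fun z hz => ?_)
    have : (-z).re ∈ Iio (-c) := by simpa using hz
    exact interior_maximal hD isOpen_Iio this
  · intro z hz
    refine (hres (-z) (by simpa using hz)).symm.trans ?_
    rw [neg_neg]

theorem mainTheorem3 {X : Type*} [NormedAddCommGroup X] [NormedSpace ℝ X] [CompleteSpace X]
    [Lattice X] [IsOrderedAddMonoid X] [IsOrderedModule ℝ X] [HasSolidNorm X]
    (T : C0Semigroup (Complexification X))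
    (P : ℕ → Complexification X →ₗ[ℂ] Complexification X)
    (hLEP : HasLEP T P)
    (hess : T.generator.essentialSpectralBound < T.generator.spectralBound) :
    ∃ s : ℝ, T.generator.spectralBound = (s : EReal) ∧ (s : ℂ) ∈ T.generator.spectrum := by
  obtain ⟨M, ω, hM⟩ := T.exists_norm_op_le
  have hωρ : ∀ z : ℂ, ω < z.re → z ∈ T.generator.resolventSet := fun z hz =>
    (C0Semigroup.isResolventAt_laplace hM hz).mem
  have hleω : T.generator.spectralBound ≤ (ω : EReal) := by
    refine sSup_le ?_
    rintro _ ⟨z, hz, rfl⟩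
    by_contra! h
    exact hz (hωρ z (EReal.coe_lt_coe_iff.1 h))
  have hbot : T.generator.spectralBound ≠ ⊥ := (bot_le.trans_lt hess).ne'
  have htop : T.generator.spectralBound ≠ ⊤ := (hleω.trans_lt (EReal.coe_lt_top ω)).ne
  obtain ⟨s, hs⟩ : ∃ s : ℝ, T.generator.spectralBound = (s : EReal) :=
    ⟨_, (EReal.coe_toReal htop hbot).symm⟩
  refine ⟨s, hs, ?_⟩
  by_contra hsρ
  replace hsρ : (s : ℂ) ∈ T.generator.resolventSet := not_not.1 hsρ
  have hgt : ∀ z : ℂ, s < z.re → z ∈ T.generator.resolventSet := fun z hz => by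
    by_contra h
    have : (z.re : EReal) ≤ T.generator.spectralBound := le_sSup ⟨z, h, rfl⟩
    rw [hs, EReal.coe_le_coe_iff] at this
    linarith
  obtain ⟨ε, hε, hball⟩ :=
    Metric.isOpen_iff.1 (LinearPMap.isOpen_resolventSet T.generator) _ hsρ
  rw [hs] at hess
  -- The first bound makes the half-plane Fredholm; `s - ε < c` keeps `(c, s]` inside the resolvent
  -- ball around `s`.
  obtain ⟨c, hc1, hc2⟩ : ∃ c : ℝ, T.generator.essentialSpectralBound < c ∧ c < s ∧ s - ε < c := by
    obtain ⟨c, h1, h2⟩ := EReal.lt_iff_exists_real_btwn.1 hess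
    refine ⟨max c (s - ε / 2), h1.trans_le (EReal.coe_le_coe_iff.2 (le_max_left _ _)),
      max_lt (EReal.coe_lt_coe_iff.1 h2) (by linarith), ?_⟩
    exact lt_of_lt_of_le (by linarith) (le_max_right _ _)
  obtain ⟨hcs, hεc⟩ := hc2
  have hray : ∀ x : ℝ, c < x → (x : ℂ) ∈ T.generator.resolventSet := by
    intro x hx
    rcases lt_or_ge s x with h | h
    · exact hgt _ (by simpa using h)
    · refine hball ?_
      rw [Metric.mem_ball, dist_eq_norm, ← Complex.ofReal_sub, Complex.norm_real, Real.norm_eq_abs,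
        abs_lt]
      constructor <;> linarith
  have hF : ∀ z : ℂ, c < z.re → z ∈ T.generator.fredholmDomain := fun z hz => by
    by_contra h
    have : (z.re : EReal) ≤ T.generator.essentialSpectralBound := le_sSup ⟨z, h, rfl⟩
    exact absurd (EReal.coe_lt_coe_iff.1 (this.trans_lt hc1)) (not_lt.2 hz.le)
  -- The `P n` are only assumed linear; `0 ≤ P n ≤ 1` makes them bounded, so that `φ ∘ P n` is a
  -- continuous functional.
  choose Q hQ using fun n => Complexification.exists_continuousLinearMap_of_le_id (hLEP.positive n)
    fun f hf => Complexification.re_le_of_increasing hLEP.increasing hLEP.tendsto_id n hf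
  let ℓ : ℕ × {φ : StrongDual ℝ X // ∀ y, 0 ≤ y → 0 ≤ φ y} → Complexification X →L[ℂ] ℂ :=
    fun i => (Complexification.extendDual i.2.1).comp (Q i.1)
  have hsep : ∀ f, (∀ i, ℓ i f = 0) → f = 0 := by
    intro f hf
    have h0 : ∀ n, P n f = 0 := fun n => by
      rw [← hQ]
      exact Complexification.eq_zero_of_forall_positive_dual fun φ hφ => hf (n, ⟨φ, hφ⟩)
    have := hLEP.tendsto_id f
    simp only [h0] at this
    exact tendsto_nhds_unique this tendsto_const_nhds
  have hextpos : ∀ i, ∀ f ∈ Complexification.positiveCone X, ∃ G : ℂ → ℂ,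
      DifferentiableOn ℂ G {z | c < z.re} ∧
        ∀ z : ℂ, ω < z.re → G z = ℓ i (T.generator.res z f) := by
    rintro ⟨n, φ, hφ⟩ f hf
    obtain rfl | hf0 := eq_or_ne f 0
    · exact ⟨fun _ => 0, differentiableOn_const _, by simp⟩
    obtain ⟨τ, -, hτ⟩ := hLEP.eventually_positive n f hf hf0
    refine C0Semigroup.exists_extension hM hray _ f τ.coe_nonneg fun t ht => ?_
    obtain ⟨h1, h2⟩ := hτ t.toNNReal (NNReal.le_toNNReal_of_coe_le ht)
    rw [← hQ] at h1 h2
    refine ⟨_, hφ _ h1, ?_⟩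
    change Complexification.extendDual φ (Q n (T.op t.toNNReal f)) = _
    rw [Complexification.extendDual_apply, h2]
    simp
  -- The positive cone spans the space, so extensions for positive vectors combine linearly.
  have hext : ∀ i f, ∃ G : ℂ → ℂ, DifferentiableOn ℂ G {z | c < z.re} ∧
      ∀ z : ℂ, ω < z.re → G z = ℓ i (T.generator.res z f) := by
    intro i f
    obtain ⟨G₁, d₁, e₁⟩ := hextpos i _ (Complexification.mem_positiveCone_mk (posPart_nonneg f.re))
    obtain ⟨G₂, d₂, e₂⟩ := hextpos i _ (Complexification.mem_positiveCone_mk (negPart_nonneg f.re))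
    obtain ⟨G₃, d₃, e₃⟩ := hextpos i _ (Complexification.mem_positiveCone_mk (posPart_nonneg f.im))
    obtain ⟨G₄, d₄, e₄⟩ := hextpos i _ (Complexification.mem_positiveCone_mk (negPart_nonneg f.im))
    refine ⟨fun z => (G₁ z - G₂ z) + Complex.I * (G₃ z - G₄ z),
      (d₁.sub d₂).add ((d₃.sub d₄).const_mul _), fun z hz => ?_⟩
    conv_rhs => rw [Complexification.eq_positive_decomposition f]
    simp only [e₁ z hz, e₂ z hz, e₃ z hz, e₄ z hz, map_add, map_sub, map_smul, smul_eq_mul]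
  have hsub := LinearPMap.halfPlane_subset_resolventSet ℓ hsep hF hωρ hext
  have hle : T.generator.spectralBound ≤ (c : EReal) := by
    refine sSup_le ?_
    rintro _ ⟨z, hz, rfl⟩
    by_contra! h
    exact hz (hsub (EReal.coe_lt_coe_iff.1 h))
  rw [hs, EReal.coe_le_coe_iff] at hle
  linarith
end
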